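/- Let $d\ge 1$, let $D\subset\mathbb{R}^d$ be a bounded domain (a nonempty, open, connected, bounded set), and let $\lambda:\overline{D}\to(0,\infty)$ be continuous. Let $\mathcal{S}(\overline{D})$ be the space of lower semicontinuous functions $\overline{D}\to\mathbb{R}\cup\{+\infty\}$, with the topology of $\Gamma$-convergence, i.e. the topology generated by the sets $\{f:\inf_U f<t\}$, $U\subset\overline D$ open, and $\{f:\inf_K f>t\}$, $K\subset\overline D$ compact, $t\in\mathbb{R}$, and with its Borel $\sigma$-algebra. Let $W_\lambda$ be a random element of $\mathcal{S}(\overline{D})$, defined on a probability space, such that 1. for every closed $C\subset\overline{D}$ the random variable $\min_{x\in C}W_\lambda(x)$ is exponentially distributed with rate $\lambda_C=\int_C\lambda(x)\,dx$ (for $\lambda_C=0$ this means that the minimum equals $+\infty$ almost surely; the minimum over the empty set is $+\infty$); 2. for all finitely many pairwise disjoint closed sets $C_1,\dots,C_n\subset\overline{D}$ the random variables $\min_{C_1}W_\lambda,\dots,\min_{C_n}W_\lambda$ are independent. For $f\in\mathcal{S}(\overline{D})$ put $m_1(f)=\min_{\overline{D}}f$ and $M_1(f)=\{x\in\overline{D}: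 f(x)=m_1(f)\}$, and for $k\ge 2$, recursively, $$m_k(f)=\inf\Big\{f(x): x\in\overline{D}\setminus\bigcup_{i=1}^{k-1}M_i(f)\Big\},\qquad M_k(f)=\{x\in\overline{D}: m_{k-1}(f)<f(x)=m_k(f)\},$$ with $\inf\emptyset=+\infty$. Let $g:\overline{D}\to\mathbb{R}$ be continuous. Then, with probability one, for every integer $k\ge 1$ the set $M_k(W_\lambda+g)$ is a singleton; that is, $W_\lambda+g$ has a well-defined and unique $k$-th argmin for every $k\ge 1$. -/

import Mathlib

open MeasureTheory ProbabilityTheory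

/-- The space `𝓢(X)` of lower semicontinuous functions on `X` with values in `ℝ ∪ {+∞}`. -/
structure LSCFun (X : Type*) [TopologicalSpace X] where
  /-- the underlying function -/
  toFun : X → EReal
  lowerSemicontinuous : LowerSemicontinuous toFun
  ne_bot : ∀ x, toFun x ≠ ⊥

instance {X : Type*} [TopologicalSpace X] : CoeFun (LSCFun X) (fun _ => X → EReal) :=
  ⟨LSCFun.toFun⟩

/-- The topology of `Γ`-convergence on `𝓢(X)`: it is generated by the sets `{f | inf_U f < t}`
with `U` open and the sets `{f | inf_K f > t}` with `K` compact, where `t` is real. -/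
instance {X : Type*} [TopologicalSpace X] : TopologicalSpace (LSCFun X) :=
  TopologicalSpace.generateFrom
    ({A | ∃ (U : Set X) (t : ℝ), IsOpen U ∧ A = {f : LSCFun X | ⨅ x ∈ U, f x < (t : EReal)}} ∪
     {A | ∃ (K : Set X) (t : ℝ), IsCompact K ∧ A = {f : LSCFun X | (t : EReal) < ⨅ x ∈ K, f x}})

instance {X : Type*} [TopologicalSpace X] : MeasurableSpace (LSCFun X) := borel (LSCFun X)

instance {X : Type*} [TopologicalSpace X] : BorelSpace (LSCFun X) := ⟨rfl⟩

open Classical in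
/-- The exponential distribution with rate `r ≥ 0`, as a law on the extended reals. The
exponential distribution with rate `0` is the Dirac mass at `+∞`. -/
noncomputable def extendedExpMeasure (r : ℝ) : Measure EReal :=
  if r = 0 then Measure.dirac ⊤ else (expMeasure r).map Real.toEReal

/-- `W` is (a version of) the extreme value process `W_lam` on the closure of `D`.
The minimum of a lower semicontinuous function over a closed (hence compact) subset `C` of the
closure of a bounded set is written as an infimum; it is `+∞` if `C` is empty. The integrals are
against Lebesgue measure on the closure of `D`. -/
structure IsExtremeValueProcess {d : ℕ} {D : Set (EuclideanSpace ℝ (Fin d))}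
    (lam : closure D → ℝ) {Ω : Type*} [MeasurableSpace Ω] (P : Measure Ω)
    (W : Ω → LSCFun (closure D)) : Prop where
  measurable : Measurable W
  hasLaw_min : ∀ C : Set (closure D), IsClosed C →
    HasLaw (fun ω => ⨅ x ∈ C, W ω x) (extendedExpMeasure (∫ x in C, lam x ∂(volume.comap Subtype.val))) P
  indep_min : ∀ (n : ℕ) (C : Fin n → Set (closure D)), (∀ i, IsClosed (C i)) →
    Pairwise (fun i j => Disjoint (C i) (C j)) →
    iIndepFun (fun (i : Fin n) (ω : Ω) => ⨅ x ∈ C i, W ω x) P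

/-- The recursive construction of the `k`-th minimum and the `k`-th argmins of `f`: for `k ≥ 1`,
the value at `k` is `(m_k(f), M_k(f), M_1(f) ∪ ⋯ ∪ M_k(f))`. The value at `0` is a dummy. -/
noncomputable def kthData {X : Type*} (f : X → EReal) : ℕ → EReal × Set X × Set X
  | 0 => (⊥, ∅, ∅)
  | 1 => (⨅ x, f x, {x | f x = ⨅ y, f y}, {x | f x = ⨅ y, f y})
  | k + 2 =>
    let p := kthData f (k + 1)
    let m : EReal := ⨅ x ∈ (p.2.2)ᶜ, f x
    let M : Set X := {x | p.1 < f x ∧ f x = m}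
    (m, M, p.2.2 ∪ M)

/-- The `k`-th minimum value `m_k(f)`, for `k ≥ 1`. -/
noncomputable def kthMin {X : Type*} (f : X → EReal) (k : ℕ) : EReal := (kthData f k).1

/-- The set `M_k(f)` of `k`-th argmins of `f`, for `k ≥ 1`. -/
noncomputable def kthArgmins {X : Type*} (f : X → EReal) (k : ℕ) : Set X := (kthData f k).2.1

theorem kthMin_one {X : Type*} (f : X → EReal) : kthMin f 1 = ⨅ x, f x := rfl

theorem kthArgmins_one {X : Type*} (f : X → EReal) :
    kthArgmins f 1 = {x | f x = kthMin f 1} := rfl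

theorem kthData_union {X : Type*} (f : X → EReal) (k : ℕ) :
    (kthData f k).2.2 = ⋃ i ∈ Finset.Icc 1 k, kthArgmins f i := by
  induction k with
  | zero => simp [kthData]
  | succ k ih =>
    have h : (kthData f (k + 1)).2.2 = (kthData f k).2.2 ∪ kthArgmins f (k + 1) := by
      cases k with
      | zero => simp [kthData, kthArgmins]
      | succ k => rfl
    rw [h, ih, ← Finset.insert_Icc_right_eq_Icc_add_one (by omega : 1 ≤ k + 1),
      Finset.set_biUnion_insert, Set.union_comm]

/-- `m_k(f)` is the infimum of `f` off `M_1(f) ∪ ⋯ ∪ M_{k-1}(f)`. -/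
theorem kthMin_succ {X : Type*} (f : X → EReal) (k : ℕ) (hk : 1 ≤ k) :
    kthMin f (k + 1) = ⨅ x ∈ (⋃ i ∈ Finset.Icc 1 k, kthArgmins f i)ᶜ, f x := by
  rw [← kthData_union]
  obtain ⟨k, rfl⟩ := Nat.exists_eq_add_of_le' hk
  rfl

/-- `M_k(f)` is the set of points where `m_{k-1}(f) < f = m_k(f)`. -/
theorem kthArgmins_succ {X : Type*} (f : X → EReal) (k : ℕ) (hk : 1 ≤ k) :
    kthArgmins f (k + 1) = {x | kthMin f k < f x ∧ f x = kthMin f (k + 1)} := by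
  obtain ⟨k, rfl⟩ := Nat.exists_eq_add_of_le' hk
  rfl

open Filter Set Topology
open scoped ENNReal

/-! ### Uniqueness of the `k`-th argmins of functions with finite sublevel sets -/

section Deterministic

variable {X : Type*} {f : X → EReal}

/-! Almost surely `W` behaves like a locally finite set of marked points: its sublevel sets are
finite, its finite values occur on a dense set, and no two finite values of `W + g` tie. The finite
values of `W + g` can then be listed in strictly increasing order, which gives the `k`-th argmins
(`exists_kthArgmins_eq_singleton`).

Both probabilistic facts use grid cells of mesh `1 / (n + 1)`, whose rates sum to at most a constant
`K` independent of `n`. The expected number of cells with minimum at most `t` is at most `t * K`.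
Distinct points end up in distinct cells, so Fatou's lemma makes sublevel sets finite
(`ae_finite_sublevel`). A tie between `x ≠ y` forces the minima over two disjoint cells to differ by
a nearly prescribed amount, up to the oscillation `ε` of `g` on cells. Independence and bounded
densities give this probability `O(ε)` after summing over all pairs, uniformly in `n`
(`ae_eq_of_add_eq_add`). -/

theorem exists_isLeast_of_finite_sublevel (hfin : ∀ t : ℝ, {x | f x ≤ t}.Finite)
    (hbot : ∀ x, f x ≠ ⊥) {s : Set X} (hs : ∃ x ∈ s, f x < ⊤) :
    ∃ x ∈ s, f x < ⊤ ∧ ∀ y ∈ s, f x ≤ f y := by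
  obtain ⟨x₀, hx₀, hlt⟩ := hs
  lift f x₀ to ℝ using ⟨hlt.ne, hbot x₀⟩ with t ht
  have hf : (s ∩ {x | f x ≤ t}).Finite := (hfin t).inter_of_right s
  obtain ⟨x, ⟨hxs, hxt⟩, hmin⟩ := hf.exists_minimalFor f _ ⟨x₀, hx₀, ht.ge⟩
  refine ⟨x, hxs, lt_of_le_of_lt hxt hlt, fun y hy => ?_⟩
  by_contra! h
  exact absurd (hmin ⟨hy, h.le.trans hxt⟩ h.le) (not_le.2 h)

/-- The last conjunct is the induction invariant: the points already removed form a full sublevel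
set. It is finite, so a finite value remains above it, and the least such value is attained once. -/
theorem kthArgmins_eq_singleton_aux (hfin : ∀ t : ℝ, {x | f x ≤ t}.Finite)
    (hbot : ∀ x, f x ≠ ⊥) (hinj : Set.InjOn f {x | f x < ⊤})
    (hinf : {x | f x < ⊤}.Infinite) (k : ℕ) :
    ∃ x, kthArgmins f (k + 1) = {x} ∧ kthMin f (k + 1) = f x ∧ f x < ⊤ ∧
      (kthData f (k + 1)).2.2 = {y | f y ≤ f x} := by
  induction k with
  | zero =>
    obtain ⟨x₀, hx₀⟩ := hinf.nonempty
    obtain ⟨x, -, hx, hmin⟩ := exists_isLeast_of_finite_sublevel hfin hbot (s := univ)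
      ⟨x₀, mem_univ _, hx₀⟩
    have hm : ⨅ y, f y = f x := le_antisymm (iInf_le _ x) (le_iInf fun y => hmin y (mem_univ y))
    have hM : {y | f y = ⨅ z, f z} = {x} := by
      ext y
      simp only [hm, mem_ofPred_eq, mem_singleton_iff]
      exact ⟨fun h => hinj (h.trans_lt hx) hx h, fun h => h ▸ rfl⟩
    refine ⟨x, hM, hm, hx, ?_⟩
    ext y
    simp only [kthData, hm, mem_ofPred_eq]
    exact ⟨le_of_eq, fun h => le_antisymm h (hmin y (mem_univ y))⟩
  | succ k ih =>
    obtain ⟨x, -, hm, hx, hU⟩ := ih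
    have hxfin : {y | f y ≤ f x}.Finite := by
      lift f x to ℝ using ⟨hx.ne, hbot x⟩ with t
      exact hfin t
    obtain ⟨y₀, hy₀, hy₀'⟩ := (hinf.sdiff hxfin).nonempty
    obtain ⟨y, hy, hyt, hmin⟩ := exists_isLeast_of_finite_sublevel hfin hbot
      (s := {z | f z ≤ f x}ᶜ) ⟨y₀, hy₀', hy₀⟩
    have hm' : ⨅ z ∈ ((kthData f (k + 1)).2.2)ᶜ, f z = f y := by
      rw [hU]
      exact le_antisymm (iInf₂_le y hy) (le_iInf₂ hmin)
    have hxy : f x < f y := not_le.1 hy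
    have hM : kthArgmins f (k + 1 + 1) = {y} := by
      ext z
      change kthMin f (k + 1) < f z ∧ f z = _ ↔ z = y
      rw [hm', hm]
      exact ⟨fun h => hinj (h.2.trans_lt hyt) hyt h.2, by rintro rfl; exact ⟨hxy, rfl⟩⟩
    refine ⟨y, hM, hm', hyt, ?_⟩
    change (kthData f (k + 1)).2.2 ∪ kthArgmins f (k + 1 + 1) = _
    rw [hM, hU]
    ext z
    simp only [mem_union, mem_ofPred_eq, mem_singleton_iff]
    refine ⟨?_, fun h => ?_⟩
    · rintro (h | rfl)
      exacts [h.trans hxy.le, le_rfl]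
    · by_cases hz : f z ≤ f x
      · exact Or.inl hz
      · exact Or.inr (hinj (h.trans_lt hyt) hyt (le_antisymm h (hmin z hz)))

/-- If `f` has finite sublevel sets and takes infinitely many finite values, each once, then
its `k`-th argmin exists and is unique for all `k ≥ 1`. -/
theorem exists_kthArgmins_eq_singleton (hfin : ∀ t : ℝ, {x | f x ≤ t}.Finite)
    (hbot : ∀ x, f x ≠ ⊥) (hinj : Set.InjOn f {x | f x < ⊤})
    (hinf : {x | f x < ⊤}.Infinite) (k : ℕ) (hk : 1 ≤ k) : ∃ x, kthArgmins f k = {x} := by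
  obtain ⟨k, rfl⟩ := Nat.exists_eq_add_of_le' hk
  obtain ⟨x, hx, -⟩ := kthArgmins_eq_singleton_aux hfin hbot hinj hinf k
  exact ⟨x, hx⟩

end Deterministic

/-! ### Bounds for the exponential distribution -/

theorem expMeasure_le (r : ℝ) {s : Set ℝ} (hs : MeasurableSet s) :
    expMeasure r s ≤ ENNReal.ofReal r * volume (s ∩ Ici 0) := by
  change (volume.withDensity (exponentialPDF r)) s ≤ _
  rw [withDensity_apply _ hs]
  calc ∫⁻ x in s, exponentialPDF r x
      ≤ ∫⁻ x in s, (Ici (0 : ℝ)).indicator (fun _ => ENNReal.ofReal r) x := by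
        refine lintegral_mono fun x => ?_
        by_cases hx : 0 ≤ x
        · rw [indicator_of_mem (mem_Ici.2 hx), exponentialPDF_of_nonneg hx]
          by_cases hr : 0 ≤ r
          · exact ENNReal.ofReal_le_ofReal (mul_le_of_le_one_right hr
              (Real.exp_le_one_iff.2 (by nlinarith)))
          · rw [ENNReal.ofReal_of_nonpos
              (mul_nonpos_of_nonpos_of_nonneg (not_le.1 hr).le (Real.exp_pos _).le)]
            exact zero_le
        · rw [exponentialPDF_of_neg (not_le.1 hx)]
          exact zero_le
    _ = ENNReal.ofReal r * volume (s ∩ Ici 0) := by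
        rw [lintegral_indicator_const measurableSet_Ici,
          Measure.restrict_apply measurableSet_Ici, inter_comm]

theorem extendedExpMeasure_Iic_le {r : ℝ} {t : ℝ} :
    extendedExpMeasure r (Iic (t : EReal)) ≤ ENNReal.ofReal t * ENNReal.ofReal r := by
  unfold extendedExpMeasure
  split_ifs with h
  · simp [measurableSet_Iic]
  · rw [Measure.map_apply measurable_coe_real_ereal measurableSet_Iic]
    have : Real.toEReal ⁻¹' Iic (t : EReal) = Iic t := by ext; simp
    rw [this]
    refine (expMeasure_le r measurableSet_Iic).trans ?_
    rw [mul_comm, inter_comm, Ici_inter_Iic, Real.volume_Icc, sub_zero]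

theorem extendedExpMeasure_toReal_mem_Icc_le {r : ℝ} (a b : ℝ) :
    extendedExpMeasure r ({x | x ≠ ⊤} ∩ EReal.toReal ⁻¹' Icc a b) ≤
      ENNReal.ofReal (b - a) * ENNReal.ofReal r := by
  have hm : MeasurableSet ({x : EReal | x ≠ ⊤} ∩ EReal.toReal ⁻¹' Icc a b) :=
    (measurableSet_singleton _).compl.inter (measurable_ereal_toReal measurableSet_Icc)
  unfold extendedExpMeasure
  split_ifs with h
  · simp [Measure.dirac_apply' _ hm]
  · rw [Measure.map_apply measurable_coe_real_ereal hm]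
    have : Real.toEReal ⁻¹' ({x : EReal | x ≠ ⊤} ∩ EReal.toReal ⁻¹' Icc a b) = Icc a b := by
      ext; simp
    rw [this]
    refine (expMeasure_le r measurableSet_Icc).trans ?_
    rw [mul_comm, ← Real.volume_Icc]
    gcongr
    exact inter_subset_left

theorem extendedExpMeasure_singleton_top {r : ℝ} (hr : r ≠ 0) :
    extendedExpMeasure r {⊤} = 0 := by
  rw [extendedExpMeasure, if_neg hr,
    Measure.map_apply measurable_coe_real_ereal (measurableSet_singleton _)]
  have : Real.toEReal ⁻¹' {⊤} = ∅ := by ext; simp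
  simp [this]

/-! ### Random functions with exponential minima over fine covers -/

section Cover

variable {X ι Ω : Type*} [MeasurableSpace Ω] {P : Measure Ω} {W : Ω → X → EReal}
  {C : ℕ → ι → Set X} {r : ℕ → ι → ℝ} {K : ℝ≥0∞}

theorem ae_finite_sublevel [Countable ι] (hcov : ∀ n x, ∃ i, x ∈ C n i)
    (hsep : ∀ x y, x ≠ y → ∀ᶠ n in atTop, ∀ i j, x ∈ C n i → y ∈ C n j →
      Disjoint (C n i) (C n j))
    (hK : K ≠ ∞) (hr : ∀ n, ∑' i, ENNReal.ofReal (r n i) ≤ K)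
    (hlaw : ∀ n i, HasLaw (fun ω => ⨅ x ∈ C n i, W ω x) (extendedExpMeasure (r n i)) P)
    (t : ℝ) : ∀ᵐ ω ∂P, {x | W ω x ≤ t}.Finite := by
  set I : EReal → ℝ≥0∞ := (Iic (t : EReal)).indicator 1 with hI
  have hIm : Measurable I := measurable_one.indicator measurableSet_Iic
  set N : ℕ → Ω → ℝ≥0∞ := fun n ω => ∑' i, I (⨅ x ∈ C n i, W ω x) with hN
  have hYm : ∀ n i, AEMeasurable (fun ω => I (⨅ x ∈ C n i, W ω x)) P := fun n i =>
    hIm.comp_aemeasurable (hlaw n i).aemeasurable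
  have hNm : ∀ n, AEMeasurable (N n) P := fun n => AEMeasurable.tsum (hYm n)
  have hNint : ∀ n, ∫⁻ ω, N n ω ∂P ≤ ENNReal.ofReal t * K := fun n => by
    rw [lintegral_tsum (hYm n)]
    refine le_trans (ENNReal.tsum_le_tsum fun i => ?_)
      ((ENNReal.tsum_mul_left).trans_le (mul_le_mul_right (hr n) _))
    rw [(hlaw n i).lintegral_comp hIm.aemeasurable, hI, lintegral_indicator_one measurableSet_Iic]
    exact extendedExpMeasure_Iic_le
  have hlim : ∫⁻ ω, liminf (fun n => N n ω) atTop ∂P ≠ ∞ := by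
    refine ((lintegral_liminf_le' hNm).trans_lt ?_).ne
    refine (liminf_le_of_le (by isBoundedDefault) fun b hb => ?_).trans_lt
      (ENNReal.mul_lt_top (ENNReal.ofReal_lt_top (r := t)) hK.lt_top)
    obtain ⟨n, hn⟩ := hb.exists
    exact hn.trans (hNint n)
  have hlimm : AEMeasurable (fun ω => liminf (fun n => N n ω) atTop) P := by
    simp_rw [liminf_eq_iSup_iInf_of_nat']
    exact AEMeasurable.iSup fun n => AEMeasurable.iInf fun i => hNm _
  filter_upwards [ae_lt_top' hlimm hlim] with ω hω
  by_contra hinf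
  obtain ⟨m, hm⟩ := ENNReal.exists_nat_gt hω.ne
  -- Any `m` points of an infinite sublevel set lie in `m` different cells for large `n`,
  -- contradicting a count below `m` infinitely often.
  have hfreq : ∃ᶠ n in atTop, N n ω < m := frequently_lt_of_liminf_lt (by isBoundedDefault) hm
  obtain ⟨s, hs, hcard⟩ := Set.Infinite.exists_subset_card_eq hinf m
  have hev : ∀ᶠ n in atTop, ∀ x ∈ s, ∀ y ∈ s, x ≠ y → ∀ i j, x ∈ C n i → y ∈ C n j →
      Disjoint (C n i) (C n j) := by
    simp only [eventually_all_finset, eventually_imp_distrib_left]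
    exact fun x _ y _ => hsep x y
  obtain ⟨n, hn, hsepn⟩ := (hfreq.and_eventually hev).exists
  choose c hc using hcov n
  have hinj : Set.InjOn c s := by
    intro x hx y hy hxy
    by_contra hne
    exact Set.disjoint_left.1 (hsepn x hx y hy hne (c x) (c y) (hc x) (hc y)) (hc x)
      (hxy ▸ hc x)
  classical
  refine absurd hn (not_lt.2 ?_)
  calc (m : ℝ≥0∞) = ∑ i ∈ s.image c, 1 := by
        rw [Finset.sum_const, Finset.card_image_of_injOn hinj, hcard]; simp
    _ ≤ ∑ i ∈ s.image c, I (⨅ x ∈ C n i, W ω x) := by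
        refine Finset.sum_le_sum fun i hi => ?_
        obtain ⟨x, hx, rfl⟩ := Finset.mem_image.1 hi
        have : ⨅ y ∈ C n (c x), W ω y ≤ t := (iInf₂_le x (hc x)).trans (hs hx)
        rw [hI, indicator_of_mem (mem_Iic.2 this)]
        rfl
    _ ≤ N n ω := ENNReal.sum_le_tsum _

/-- By Fubini: with `Z` fixed, `Y` must fall in an interval of length `2 * ε`, where its density is
at most `p`. Excluding `⊤` avoids the default value of `toReal`. -/
theorem measure_toReal_sub_mem_Icc_le [IsProbabilityMeasure P] {Y Z : Ω → EReal} {p q : ℝ}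
    (hY : HasLaw Y (extendedExpMeasure p) P) (hZ : HasLaw Z (extendedExpMeasure q) P)
    (hYZ : IndepFun Y Z P) (a ε t : ℝ) :
    P {ω | Y ω ≠ ⊤ ∧ Z ω ≤ t ∧ |(Y ω).toReal - (Z ω).toReal - a| ≤ ε} ≤
      ENNReal.ofReal (2 * ε) * ENNReal.ofReal p * (ENNReal.ofReal t * ENNReal.ofReal q) := by
  have := hY.isProbabilityMeasure_iff.1 inferInstance
  have := hZ.isProbabilityMeasure_iff.1 inferInstance
  set S : Set (EReal × EReal) :=
    {z | z.1 ≠ ⊤ ∧ z.2 ≤ t ∧ |z.1.toReal - z.2.toReal - a| ≤ ε} with hS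
  have hSm : MeasurableSet S := by
    have h : Measurable fun z : EReal × EReal => |z.1.toReal - z.2.toReal - a| :=
      (((measurable_ereal_toReal.comp measurable_fst).sub
        (measurable_ereal_toReal.comp measurable_snd)).sub_const a).abs
    exact (measurable_fst (measurableSet_singleton ⊤).compl).inter
      ((measurable_snd measurableSet_Iic).inter (h measurableSet_Iic))
  have hprod : P.map (fun ω => (Y ω, Z ω)) =
      (extendedExpMeasure p).prod (extendedExpMeasure q) := by
    rw [(indepFun_iff_map_prod_eq_prod_map_map hY.aemeasurable hZ.aemeasurable).1 hYZ,
      hY.map_eq, hZ.map_eq]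
  change P ((fun ω => (Y ω, Z ω)) ⁻¹' S) ≤ _
  rw [← Measure.map_apply_of_aemeasurable (hY.aemeasurable.prodMk hZ.aemeasurable) hSm, hprod,
    Measure.prod_apply_symm hSm]
  calc ∫⁻ z, extendedExpMeasure p ((fun y => (y, z)) ⁻¹' S) ∂extendedExpMeasure q
      ≤ ∫⁻ z, (Iic (t : EReal)).indicator
          (fun _ => ENNReal.ofReal (2 * ε) * ENNReal.ofReal p) z ∂extendedExpMeasure q := by
        refine lintegral_mono fun z => ?_
        by_cases hz : z ≤ t
        · rw [indicator_of_mem (mem_Iic.2 hz)]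
          refine (measure_mono fun y hy => ?_).trans ((extendedExpMeasure_toReal_mem_Icc_le
            (z.toReal + a - ε) (z.toReal + a + ε)).trans_eq (by ring_nf))
          have := abs_le.1 hy.2.2
          exact ⟨hy.1, by simp only at this; linarith, by simp only at this; linarith⟩
        · have : (fun y => (y, z)) ⁻¹' S = ∅ := by
            ext y; simp [hS, hz]
          rw [this, measure_empty]
          exact zero_le
    _ ≤ _ := by
        rw [lintegral_indicator_const measurableSet_Iic]
        gcongr
        exact extendedExpMeasure_Iic_le

theorem ae_eq_of_add_eq_add [Countable ι] [IsProbabilityMeasure P]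
    (hcov : ∀ n x, ∃ i, x ∈ C n i)
    (hsep : ∀ x y, x ≠ y → ∀ᶠ n in atTop, ∀ i j, x ∈ C n i → y ∈ C n j →
      Disjoint (C n i) (C n j))
    (hK : K ≠ ∞) (hr : ∀ n, ∑' i, ENNReal.ofReal (r n i) ≤ K)
    (hlaw : ∀ n i, HasLaw (fun ω => ⨅ x ∈ C n i, W ω x) (extendedExpMeasure (r n i)) P)
    (hindep : ∀ n i j, Disjoint (C n i) (C n j) →
      IndepFun (fun ω => ⨅ x ∈ C n i, W ω x) (fun ω => ⨅ x ∈ C n j, W ω x) P)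
    (hbot : ∀ ω x, W ω x ≠ ⊥) {g : X → ℝ}
    (hg : ∀ ε > 0, ∀ᶠ n in atTop, ∃ p : ι → ℝ, ∀ i, ∀ x ∈ C n i, |g x - p i| ≤ ε)
    (t : ℝ) :
    ∀ᵐ ω ∂P, ∀ x y, W ω x ≤ t → W ω y ≤ t → W ω x + g x = W ω y + g y → x = y := by
  have hfin := ae_finite_sublevel hcov hsep hK hr hlaw t
  -- Finiteness is built into `B` so that a single `n` separates all pairs of sublevel points.
  set B : Set Ω := {ω | {x | W ω x ≤ t}.Finite ∧ ∃ x y, W ω x ≤ t ∧ W ω y ≤ t ∧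
    W ω x + g x = W ω y + g y ∧ x ≠ y} with hB
  suffices h : P B = 0 by
    filter_upwards [hfin, measure_eq_zero_iff_ae_notMem.1 h] with ω hω hωB x y hx hy hxy
    by_contra hne
    exact hωB ⟨hω, x, y, hx, hy, hxy, hne⟩
  have hbound : ∀ ε > 0, P B ≤ ENNReal.ofReal (4 * ε) * (K * (ENNReal.ofReal t * K)) := by
    intro ε hε
    obtain ⟨n₀, hn₀⟩ := eventually_atTop.1 (hg ε hε)
    choose! p hp using hn₀
    set E : ℕ → ι × ι → Set Ω := fun n z => {ω | Disjoint (C n z.1) (C n z.2) ∧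
      (⨅ x ∈ C n z.1, W ω x) ≠ ⊤ ∧ (⨅ x ∈ C n z.2, W ω x) ≤ t ∧
      |(⨅ x ∈ C n z.1, W ω x).toReal - (⨅ x ∈ C n z.2, W ω x).toReal -
        (p n z.2 - p n z.1)| ≤ 2 * ε} with hE
    have hEle : ∀ n, P (⋃ z, E n z) ≤ ENNReal.ofReal (4 * ε) * (K * (ENNReal.ofReal t * K)) := by
      intro n
      calc P (⋃ z, E n z) ≤ ∑' z, P (E n z) := measure_iUnion_le _
        _ ≤ ∑' z : ι × ι, ENNReal.ofReal (4 * ε) * (ENNReal.ofReal (r n z.1) *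
              (ENNReal.ofReal t * ENNReal.ofReal (r n z.2))) := by
            refine ENNReal.tsum_le_tsum fun z => ?_
            by_cases hd : Disjoint (C n z.1) (C n z.2)
            · refine (measure_mono fun ω hω => hω.2).trans
                ((measure_toReal_sub_mem_Icc_le (hlaw n z.1) (hlaw n z.2)
                  (hindep n _ _ hd) (p n z.2 - p n z.1) (2 * ε) t).trans_eq ?_)
              rw [mul_assoc]
              ring_nf
            · simp [hE, hd]
        _ ≤ _ := by
            rw [ENNReal.tsum_mul_left]
            gcongr
            rw [ENNReal.tsum_prod (f := fun i j => ENNReal.ofReal (r n i) *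
              (ENNReal.ofReal t * ENNReal.ofReal (r n j)))]
            simp_rw [ENNReal.tsum_mul_left, ENNReal.tsum_mul_right]
            gcongr <;> exact hr n
    -- The threshold for `n` depends on `ω`; the increasing union over `m` absorbs this, and
    -- continuity from below keeps the bound.
    have hsub : B ⊆ ⋃ m, ⋂ n ≥ m, ⋃ z, E n z := by
      rintro ω ⟨hω, x, y, hx, hy, hxy, hne⟩
      have hev : ∀ᶠ n in atTop, ∀ u ∈ {x | W ω x ≤ t}, ∀ v ∈ {x | W ω x ≤ t}, u ≠ v →
          ∀ i j, u ∈ C n i → v ∈ C n j → Disjoint (C n i) (C n j) := by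
        simp only [eventually_all_finite hω, eventually_imp_distrib_left]
        exact fun u _ v _ => hsep u v
      obtain ⟨m, hm⟩ := eventually_atTop.1 (hev.and (eventually_ge_atTop n₀))
      simp only [mem_iUnion, mem_iInter]
      refine ⟨m, fun n hn => ?_⟩
      obtain ⟨hsepn, hnn⟩ := hm n hn
      -- Two sublevel points in one cell would make that cell disjoint from itself.
      have hmin : ∀ u i, W ω u ≤ t → u ∈ C n i → ⨅ x ∈ C n i, W ω x = W ω u := by
        intro u i hu hui
        refine le_antisymm (iInf₂_le u hui) (le_iInf₂ fun v hv => ?_)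
        by_cases hvt : W ω v ≤ t
        · by_cases huv : u = v
          · rw [huv]
          · exact absurd hv (Set.disjoint_left.1 (hsepn u hu v hvt huv i i hui hv) · hv)
        · exact hu.trans (not_le.1 hvt).le
      obtain ⟨i, hi⟩ := hcov n x
      obtain ⟨j, hj⟩ := hcov n y
      have hxT : W ω x ≠ ⊤ := (hx.trans_lt (EReal.coe_lt_top t)).ne
      have hyT : W ω y ≠ ⊤ := (hy.trans_lt (EReal.coe_lt_top t)).ne
      refine ⟨(i, j), hsepn x hx y hy hne i j hi hj, ?_⟩
      rw [hmin x i hx hi, hmin y j hy hj]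
      refine ⟨hxT, hy, ?_⟩
      have h1 := abs_le.1 (hp n hnn i x hi)
      have h2 := abs_le.1 (hp n hnn j y hj)
      lift W ω x to ℝ using ⟨hxT, hbot ω x⟩ with u
      lift W ω y to ℝ using ⟨hyT, hbot ω y⟩ with v
      rw [← EReal.coe_add, ← EReal.coe_add, EReal.coe_eq_coe_iff] at hxy
      rw [EReal.toReal_coe, EReal.toReal_coe, abs_le]
      constructor <;> linarith
    have hmono : Monotone fun m => ⋂ n ≥ m, ⋃ z, E n z := fun a b hab =>
      biInter_subset_biInter_left fun n (hn : b ≤ n) => hab.trans hn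
    refine (measure_mono hsub).trans ?_
    rw [hmono.measure_iUnion]
    exact iSup_le fun m => (measure_mono (biInter_subset_of_mem (le_refl m))).trans (hEle m)
  have hfinite : K * (ENNReal.ofReal t * K) ≠ ∞ := by finiteness
  have hlim : Tendsto (fun ε : ℝ => ENNReal.ofReal (4 * ε) * (K * (ENNReal.ofReal t * K)))
      (𝓝[>] 0) (𝓝 0) := by
    have h : Tendsto (fun ε : ℝ => 4 * ε) (𝓝[>] 0) (𝓝 0) :=
      ((continuous_const.mul continuous_id).tendsto' 0 0 (by simp)).mono_left nhdsWithin_le_nhds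
    simpa using ENNReal.Tendsto.mul_const (ENNReal.tendsto_ofReal h) (Or.inr hfinite)
  exact le_antisymm (ge_of_tendsto hlim
    (eventually_nhdsWithin_of_forall fun ε hε => hbound ε hε)) zero_le

end Cover

/-! ### Closed grid cells in Euclidean space -/

section Grid

variable {d : ℕ}

/-- The closed cube with lower corner `z / (n + 1)` and side length `1 / (n + 1)`. -/
def gridCell (n : ℕ) (z : Fin d → ℤ) : Set (EuclideanSpace ℝ (Fin d)) :=
  {x | ∀ k, (z k : ℝ) ≤ (n + 1) * x k ∧ (n + 1) * x k ≤ z k + 1}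

theorem isClosed_gridCell (n : ℕ) (z : Fin d → ℤ) : IsClosed (gridCell n z) := by
  have : gridCell n z = ⋂ k, {x : EuclideanSpace ℝ (Fin d) |
      (z k : ℝ) ≤ (n + 1) * x k ∧ (n + 1) * x k ≤ z k + 1} := by
    ext; simp [gridCell]
  rw [this]
  refine isClosed_iInter fun k => ?_
  have hc : Continuous fun x : EuclideanSpace ℝ (Fin d) => ((n : ℝ) + 1) * x k := by fun_prop
  exact (isClosed_le continuous_const hc).inter (isClosed_le hc continuous_const)

theorem exists_mem_gridCell (n : ℕ) (x : EuclideanSpace ℝ (Fin d)) : ∃ z, x ∈ gridCell n z :=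
  ⟨fun k => ⌊((n : ℝ) + 1) * x k⌋, fun _ => ⟨Int.floor_le _, (Int.lt_floor_add_one _).le⟩⟩

theorem abs_sub_le_of_mem_gridCell {n : ℕ} {z : Fin d → ℤ} {x y : EuclideanSpace ℝ (Fin d)}
    (hx : x ∈ gridCell n z) (hy : y ∈ gridCell n z) (k : Fin d) :
    |x k - y k| ≤ 1 / ((n : ℝ) + 1) := by
  have hn : (0 : ℝ) < n + 1 := by positivity
  rw [abs_sub_le_iff, le_div_iff₀' hn, le_div_iff₀' hn]
  constructor <;> linarith [hx k, hy k]

theorem dist_le_of_mem_gridCell {n : ℕ} {z : Fin d → ℤ} {x y : EuclideanSpace ℝ (Fin d)}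
    (hx : x ∈ gridCell n z) (hy : y ∈ gridCell n z) :
    dist x y ≤ √d * (1 / ((n : ℝ) + 1)) := by
  rw [EuclideanSpace.dist_eq]
  refine Real.sqrt_le_iff.2 ⟨by positivity, ?_⟩
  calc ∑ k, dist (x k) (y k) ^ 2 ≤ ∑ _k : Fin d, (1 / ((n : ℝ) + 1)) ^ 2 := by
        gcongr with k
        exact abs_sub_le_of_mem_gridCell hx hy k
    _ = (√d * (1 / ((n : ℝ) + 1))) ^ 2 := by
        rw [mul_pow, Real.sq_sqrt (by positivity)]
        simp

theorem tendsto_diam_gridCell (d : ℕ) :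
    Tendsto (fun n : ℕ => √d * (1 / ((n : ℝ) + 1))) atTop (𝓝 0) := by
  simpa using tendsto_one_div_add_atTop_nhds_zero_nat.const_mul √d

theorem eventually_disjoint_gridCell {x y : EuclideanSpace ℝ (Fin d)} (hxy : x ≠ y) :
    ∀ᶠ n in atTop, ∀ i j, x ∈ gridCell n i → y ∈ gridCell n j →
      Disjoint (gridCell n i) (gridCell n j) := by
  filter_upwards [(tendsto_diam_gridCell d).eventually_lt_const
    (half_pos (dist_pos.2 hxy))] with n hn i j hi hj
  refine Set.disjoint_left.2 fun u hui huj => ?_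
  have h1 := dist_le_of_mem_gridCell hi hui
  have h2 := dist_le_of_mem_gridCell huj hj
  linarith [dist_triangle x u y]

/-- Closed cells share faces, but each coordinate leaves only two candidate indices. This
multiplicity bound supplies the constant `K`. -/
theorem tsum_indicator_gridCell_le (n : ℕ) (x : EuclideanSpace ℝ (Fin d)) :
    ∑' z, (gridCell n z).indicator (1 : EuclideanSpace ℝ (Fin d) → ℝ≥0∞) x ≤ 2 ^ d := by
  classical
  set s : Finset (Fin d → ℤ) := Fintype.piFinset fun k =>
    Finset.Icc (⌊((n : ℝ) + 1) * x k⌋ - 1) ⌊((n : ℝ) + 1) * x k⌋ with hs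
  have hmem : ∀ z, z ∉ s → (gridCell n z).indicator (1 : EuclideanSpace ℝ (Fin d) → ℝ≥0∞) x = 0 := by
    refine fun z hz => indicator_of_notMem (fun hx => hz ?_) _
    rw [hs, Fintype.mem_piFinset]
    refine fun k => Finset.mem_Icc.2 ⟨?_, Int.le_floor.2 (hx k).1⟩
    have : ⌊((n : ℝ) + 1) * x k⌋ ≤ ⌊((z k : ℝ) + 1)⌋ := Int.floor_le_floor (hx k).2
    rw [Int.floor_add_one, Int.floor_intCast] at this
    omega
  rw [tsum_eq_sum hmem]
  calc ∑ z ∈ s, (gridCell n z).indicator (1 : EuclideanSpace ℝ (Fin d) → ℝ≥0∞) x ≤ ∑ _z ∈ s, 1 :=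
        Finset.sum_le_sum fun z _ => indicator_le_self' (fun _ _ => zero_le) x
    _ = 2 ^ d := by simp [hs]

theorem tsum_measure_preimage_gridCell_le {Y : Type*} [MeasurableSpace Y] (ν : Measure Y)
    {φ : Y → EuclideanSpace ℝ (Fin d)} (hφ : Measurable φ) (n : ℕ) :
    ∑' z, ν (φ ⁻¹' gridCell n z) ≤ 2 ^ d * ν univ := by
  have hm : ∀ z : Fin d → ℤ, MeasurableSet (φ ⁻¹' gridCell n z) := fun z =>
    hφ (isClosed_gridCell n z).measurableSet
  calc ∑' z, ν (φ ⁻¹' gridCell n z)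
      = ∑' z, ∫⁻ y, (φ ⁻¹' gridCell n z).indicator 1 y ∂ν := by
        simp_rw [lintegral_indicator_one (hm _)]
    _ = ∫⁻ y, ∑' z, (gridCell n z).indicator (1 : EuclideanSpace ℝ (Fin d) → ℝ≥0∞) (φ y) ∂ν :=
        (lintegral_tsum fun z => (measurable_one.indicator (hm z)).aemeasurable).symm
    _ ≤ ∫⁻ _, 2 ^ d ∂ν := lintegral_mono fun y => tsum_indicator_gridCell_le n (φ y)
    _ = 2 ^ d * ν univ := lintegral_const _

theorem eventually_exists_abs_sub_le_of_mem_gridCell {s : Set (EuclideanSpace ℝ (Fin d))}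
    {g : s → ℝ} (hg : UniformContinuous g) {ε : ℝ} (hε : 0 < ε) :
    ∀ᶠ n in atTop, ∃ p : (Fin d → ℤ) → ℝ, ∀ i, ∀ x ∈ (Subtype.val ⁻¹' gridCell n i : Set s),
      |g x - p i| ≤ ε := by
  classical
  obtain ⟨δ, hδ, hgδ⟩ := Metric.uniformContinuous_iff.1 hg ε hε
  filter_upwards [(tendsto_diam_gridCell d).eventually_lt_const hδ] with n hn
  refine ⟨fun i => if h : (Subtype.val ⁻¹' gridCell n i : Set s).Nonempty then g h.some else 0,
    fun i x hx => ?_⟩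
  have h : (Subtype.val ⁻¹' gridCell n i : Set s).Nonempty := ⟨x, hx⟩
  simp only [dif_pos h]
  exact (hgδ ((dist_le_of_mem_gridCell hx h.some_mem).trans_lt hn)).le

end Grid

/-! ### Lebesgue measure on the closure of a bounded open set -/

section Closure

variable {d : ℕ} {D : Set (EuclideanSpace ℝ (Fin d))}

theorem comap_val_closure_apply (s : Set (closure D)) :
    (volume.comap Subtype.val : Measure (closure D)) s = volume (Subtype.val '' s) :=
  (MeasurableEmbedding.subtype_coe isClosed_closure.measurableSet).comap_apply _ _

theorem isFiniteMeasure_comap_val_closure (hD : Bornology.IsBounded D) :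
    IsFiniteMeasure (volume.comap Subtype.val : Measure (closure D)) := by
  refine ⟨?_⟩
  rw [comap_val_closure_apply, image_univ, Subtype.range_coe]
  exact hD.closure.measure_lt_top

theorem comap_val_closure_pos (hD : IsOpen D) {U : Set (closure D)} (hU : IsOpen U)
    (hne : U.Nonempty) : 0 < (volume.comap Subtype.val : Measure (closure D)) U := by
  rw [comap_val_closure_apply]
  obtain ⟨V, hV, rfl⟩ := isOpen_induced_iff.1 hU
  obtain ⟨x, hx⟩ := hne
  have hVD : (V ∩ D).Nonempty := mem_closure_iff.1 x.2 V hV hx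
  refine ((hV.inter hD).measure_pos volume hVD).trans_le (measure_mono fun y hy => ?_)
  exact ⟨⟨y, subset_closure hy.2⟩, hy.1, rfl⟩

theorem infinite_closure (hd : 1 ≤ d) (hD : IsOpen D) (hne : D.Nonempty) :
    Infinite (closure D) := by
  have : Nonempty (Fin d) := ⟨⟨0, hd⟩⟩
  have h : D.Infinite := fun h => (hD.measure_pos volume hne).ne' (h.measure_zero volume)
  exact (h.mono subset_closure).to_subtype

end Closure

/-! ### Pairwise independence and finite values of the extreme value process -/

namespace IsExtremeValueProcess

variable {d : ℕ} {D : Set (EuclideanSpace ℝ (Fin d))} {lam : closure D → ℝ}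
  {Ω : Type*} [MeasurableSpace Ω] {P : Measure Ω} {W : Ω → LSCFun (closure D)}

theorem indepFun_min (hW : IsExtremeValueProcess lam P W) {A B : Set (closure D)}
    (hA : IsClosed A) (hB : IsClosed B) (hAB : Disjoint A B) :
    IndepFun (fun ω => ⨅ x ∈ A, W ω x) (fun ω => ⨅ x ∈ B, W ω x) P := by
  have h := hW.indep_min 2 ![A, B] (by simp [Fin.forall_fin_two, hA, hB])
    (by
      intro i j hij
      fin_cases i <;> fin_cases j <;> simp_all [disjoint_comm])
  exact h.indepFun (i := 0) (j := 1) (by decide)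

/-- Almost surely, the process takes finite values on every nonempty open set. -/
theorem ae_exists_lt_top (hW : IsExtremeValueProcess lam P W) (hD : IsOpen D)
    (hint : Integrable lam (volume.comap Subtype.val)) (hpos : ∀ x, 0 < lam x) :
    ∀ᵐ ω ∂P, ∀ U : Set (closure D), IsOpen U → U.Nonempty → ∃ x ∈ U, W ω x < ⊤ := by
  have hball : ∀ (x : closure D) (n : ℕ),
      ∀ᵐ ω ∂P, ∃ y ∈ Metric.closedBall x (1 / ((n : ℝ) + 1)), W ω y < ⊤ := by
    intro x n
    set F := Metric.closedBall x (1 / ((n : ℝ) + 1))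
    have hF : IsClosed F := Metric.isClosed_closedBall
    have hr : 0 < ∫ x in F, lam x ∂(volume.comap Subtype.val) := by
      rw [setIntegral_pos_iff_support_of_nonneg_ae (ae_of_all _ fun x => (hpos x).le)
        hint.integrableOn]
      have : Function.support lam = univ := by
        ext x; simp [(hpos x).ne']
      rw [this, univ_inter]
      exact (comap_val_closure_pos hD Metric.isOpen_ball
        ⟨x, Metric.mem_ball_self (by positivity)⟩).trans_le
          (measure_mono Metric.ball_subset_closedBall)
    have h := (hW.hasLaw_min F hF).measure_eq (p := (· = ⊤)) (measurableSet_singleton ⊤)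
    rw [ofPred_eq_eq_singleton, extendedExpMeasure_singleton_top hr.ne'] at h
    filter_upwards [measure_eq_zero_iff_ae_notMem.1 h] with ω hω
    have hω' : ⨅ y ∈ F, W ω y < ⊤ := lt_top_iff_ne_top.2 hω
    simpa only [iInf_lt_iff, exists_prop] using hω'
  -- Countably many balls suffice, so one null set serves all open sets.
  obtain ⟨S, hSc, hSd⟩ := TopologicalSpace.exists_countable_dense (closure D)
  filter_upwards [(ae_ball_iff hSc).2 fun x _ => ae_all_iff.2 (hball x)] with ω hω U hU ⟨u, hu⟩
  obtain ⟨ε, hε, hεU⟩ := Metric.isOpen_iff.1 hU u hu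
  obtain ⟨n, hn⟩ := exists_nat_one_div_lt (half_pos hε)
  obtain ⟨x, hxS, hx⟩ := hSd.exists_dist_lt u (half_pos hε)
  obtain ⟨y, hy, hyt⟩ := hω x hxS n
  refine ⟨y, hεU ?_, hyt⟩
  rw [Metric.mem_closedBall] at hy
  rw [Metric.mem_ball]
  linarith [dist_triangle y x u, dist_comm u x]

end IsExtremeValueProcess

theorem mainTheorem6 {d : ℕ} (hd : 1 ≤ d) (D : Set (EuclideanSpace ℝ (Fin d)))
    (hD_open : IsOpen D) (hD_conn : IsConnected D) (hD_bdd : Bornology.IsBounded D)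
    (lam : closure D → ℝ) (hlam_cont : Continuous lam) (hlam_pos : ∀ x, 0 < lam x)
    {Ω : Type*} [MeasurableSpace Ω] (P : Measure Ω) [IsProbabilityMeasure P]
    (W : Ω → LSCFun (closure D)) (hW : IsExtremeValueProcess lam P W)
    (g : closure D → ℝ) (hg : Continuous g) :
    ∀ᵐ ω ∂P, ∀ k : ℕ, 1 ≤ k →
      ∃ x : closure D, kthArgmins (fun y => W ω y + (g y : EReal)) k = {x} := by
  have : CompactSpace (closure D) := isCompact_iff_compactSpace.1 hD_bdd.isCompact_closure
  have : Infinite (closure D) := infinite_closure hd hD_open hD_conn.nonempty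
  set μ : Measure (closure D) := volume.comap Subtype.val with hμ
  have : IsFiniteMeasure μ := isFiniteMeasure_comap_val_closure hD_bdd
  have hint : Integrable lam μ := hlam_cont.integrable_of_hasCompactSupport
    (HasCompactSupport.of_compactSpace lam)
  set ν : Measure (closure D) := μ.withDensity fun x => ENNReal.ofReal (lam x) with hν
  set C : ℕ → (Fin d → ℤ) → Set (closure D) := fun n z => Subtype.val ⁻¹' gridCell n z with hC
  have hCc : ∀ n z, IsClosed (C n z) := fun n z =>
    (isClosed_gridCell n z).preimage continuous_subtype_val
  have hrate : ∀ n z, ENNReal.ofReal (∫ x in C n z, lam x ∂μ) = ν (C n z) := fun n z => by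
    rw [hν, withDensity_apply _ (hCc n z).measurableSet]
    exact ofReal_integral_eq_lintegral_ofReal hint.integrableOn
      (ae_of_all _ fun x => (hlam_pos x).le)
  have : IsFiniteMeasure ν := isFiniteMeasure_withDensity_ofReal hint.2
  have hK : 2 ^ d * ν univ ≠ ∞ := by finiteness
  have hr : ∀ n, ∑' z, ENNReal.ofReal (∫ x in C n z, lam x ∂μ) ≤ 2 ^ d * ν univ := fun n => by
    simp_rw [hrate]
    exact tsum_measure_preimage_gridCell_le ν measurable_subtype_coe n
  have hcov : ∀ n x, ∃ z, x ∈ C n z := fun n x => exists_mem_gridCell n x.1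
  have hsep : ∀ x y, x ≠ y → ∀ᶠ n in atTop, ∀ i j, x ∈ C n i → y ∈ C n j →
      Disjoint (C n i) (C n j) := fun x y hxy =>
    (eventually_disjoint_gridCell (Subtype.coe_injective.ne hxy)).mono
      fun n hn i j hi hj => (hn i j hi hj).preimage _
  have hlaw : ∀ n z, HasLaw (fun ω => ⨅ x ∈ C n z, W ω x)
      (extendedExpMeasure (∫ x in C n z, lam x ∂μ)) P := fun n z => hW.hasLaw_min _ (hCc n z)
  have hfin : ∀ᵐ ω ∂P, ∀ t : ℕ, {x | W ω x ≤ ((t : ℝ) : EReal)}.Finite :=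
    ae_all_iff.2 fun t => ae_finite_sublevel hcov hsep hK hr hlaw t
  have hinj : ∀ᵐ ω ∂P, ∀ t : ℕ, ∀ x y, W ω x ≤ ((t : ℝ) : EReal) → W ω y ≤ ((t : ℝ) : EReal) →
      W ω x + g x = W ω y + g y → x = y :=
    ae_all_iff.2 fun t => ae_eq_of_add_eq_add hcov hsep hK hr hlaw
      (fun n i j => hW.indepFun_min (hCc n i) (hCc n j)) (fun ω => (W ω).ne_bot)
      (fun ε hε => eventually_exists_abs_sub_le_of_mem_gridCell
        (CompactSpace.uniformContinuous_of_continuous hg) hε) t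
  obtain ⟨b, hb⟩ := (isCompact_range hg).bddBelow
  filter_upwards [hfin, hinj, hW.ae_exists_lt_top hD_open hint hlam_pos] with ω hfin hinj hdense
  have htop : ∀ x, W ω x + (g x : EReal) < ⊤ ↔ W ω x < ⊤ := fun x => by
    simp [lt_top_iff_ne_top, EReal.add_ne_top_iff_ne_top_left]
  refine exists_kthArgmins_eq_singleton (fun t => ?_) (fun x => ?_) (fun x hx y hy hxy => ?_) ?_
  -- As `g ≥ b`, the sublevel set of `W + g` at `t` lies in that of `W` at `t - b`.
  · obtain ⟨n, hn⟩ := exists_nat_ge (t - b)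
    refine (hfin n).subset fun x (hx : W ω x + (g x : EReal) ≤ t) => ?_
    have hx' : W ω x ≠ ⊤ :=
      ((htop x).1 (hx.trans_lt (EReal.coe_lt_top t))).ne
    change W ω x ≤ _
    have hbx : b ≤ g x := hb (mem_range_self x)
    have := (W ω).ne_bot x
    lift W ω x to ℝ using ⟨hx', this⟩ with u
    norm_cast at hx ⊢
    linarith
  · simp [EReal.add_eq_bot_iff, (W ω).ne_bot x]
  · have hmax : max (W ω x) (W ω y) < ⊤ := max_lt ((htop x).1 hx) ((htop y).1 hy)
    obtain ⟨t, ht⟩ := EReal.lt_iff_exists_real_btwn.1 hmax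
    obtain ⟨n, hn⟩ := exists_nat_ge t
    have hle : max (W ω x) (W ω y) ≤ ((n : ℝ) : EReal) :=
      ht.1.le.trans (EReal.coe_le_coe_iff.2 hn)
    exact hinj n x y ((le_max_left _ _).trans hle) ((le_max_right _ _).trans hle) hxy
  -- Were the set of finite values finite, its complement would be open and nonempty, contradicting
  -- density.
  · simp_rw [htop]
    intro hf
    obtain ⟨x, hx, hxt⟩ := hdense _ hf.isClosed.isOpen_compl hf.infinite_compl.nonempty
    exact hx hxt
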